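/- A hypergraph $\mathcal{H}=(V,E)$ consists of a finite set $V$ of vertices and a set $E$ of nonempty subsets of $V$ (the edges). The degree of a vertex is the number of edges that contain it. A set $I\subseteq V$ is independent if $e\not\subseteq I$ for every $e\in E$, and the independence polynomial of $\mathcal{H}$ is $$Z(\mathcal{H};\lambda)=\sum_{I\subseteq V\text{ independent}}\lambda^{|I|}.$$ Let $\Delta\ge 3$ be an integer and let $\lambda_c(\Delta)=\dfrac{(\Delta-1)^{\Delta-1}}{(\Delta-2)^{\Delta}}$. Then there exists an open set $U\subseteq\mathbb{C}$ containing the real interval $(0,\lambda_c(\Delta))$ such that for every hypergraph $\mathcal{H}$ of maximum degree at most $\Delta$ and every $\lambda\in U$ we have $Z(\mathcal{H};\lambda)\neq 0$. -/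

import Mathlib

namespace Hypergraph

/-- `U` is an independent set of the hypergraph `H`: a set of vertices that contains no edge. -/
def IsIndepSet {α : Type*} (H : Hypergraph α) (U : Set α) : Prop :=
  U ⊆ H.vertexSet ∧ ∀ e ∈ H.edgeSet, ¬ e ⊆ U

/-- The degree of a vertex: the number of edges that contain it. -/
noncomputable def degree {α : Type*} (H : Hypergraph α) (v : α) : ℕ :=
  {e | e ∈ H.edgeSet ∧ v ∈ e}.ncard

/-- The maximum degree of `H` is at most `Δ`. -/
def MaxDegreeLE {α : Type*} (H : Hypergraph α) (Δ : ℕ) : Prop :=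
  ∀ v ∈ H.vertexSet, H.degree v ≤ Δ

open scoped Classical in
/-- The multivariate independence polynomial of a hypergraph with finite vertex set: the sum over
the independent sets `U` of the products of the variables of the vertices in `U`. -/
noncomputable def multiIndepPoly {α : Type*} (H : Hypergraph α) (hV : H.vertexSet.Finite)
    (lam : α → ℂ) : ℂ :=
  ∑ U ∈ hV.toFinset.powerset.filter (fun U : Finset α => H.IsIndepSet (U : Set α)),
    ∏ v ∈ U, lam v

/-- The univariate independence polynomial, in which all variables are equal to `lam`. -/
noncomputable def indepPoly {α : Type*} (H : Hypergraph α) (hV : H.vertexSet.Finite)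
    (lam : ℂ) : ℂ :=
  H.multiIndepPoly hV (fun _ => lam)

end Hypergraph

/-- The critical value `(Δ - 1)^(Δ - 1) / (Δ - 2)^Δ`; it is used for `Δ ≥ 3` only. -/
noncomputable def lambdaC (Δ : ℕ) : ℝ :=
  ((Δ : ℝ) - 1) ^ (Δ - 1) / ((Δ : ℝ) - 2) ^ Δ

/-! Adding an edge f multiplies Z by 1 - p, where p is the complex probability that a random
independent set contains f. Delete v and restore the edges through v, shrunk by v, one at a time:
Z(V, E) equals Z of the edges avoiding v times 1 + R, with R = λ∏(1 - p_e), and v is occupied with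
probability R/(1 + R). By the chain rule, probabilities of larger sets are products. So
(`Hypergraph.isZeroFree`) it suffices to find a set containing 0, closed under multiplication and
under this recursion with at most d = Δ - 1 factors, such that 1 + R ≠ 0 with at most d + 1 factors.

A thin `lens τ` works: with c = (1 + τ²)^(-1/2) it is the set ‖p‖ < 1, c‖1 - p‖ ≤ 1 - ‖p‖. For R of
modulus r and argument φ, stability follows from φ²r ≤ (1 - c²)(1 + r). Up to slack, |φ| ≤ τ∑a_i and
r ≤ μ∏(1 - a_i²), so as τ → 0 the requirement becomes (∑a_i)²r < 1 + r. By Cauchy-Schwarz this rests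
on `prod_one_sub_mul_le`, whose sharp constant is 1/λ_c. -/

/-! ### Geometry of the lens -/

/-- The region of complex probabilities `s ^ 2`, where `s` lies between the two circular arcs
through `1` and `-1` given by `2 * |Im s| = τ * (1 - ‖s‖ ^ 2)`. -/
def lens (τ : ℝ) : Set ℂ :=
  {p | ∃ s : ℂ, s ^ 2 = p ∧ ‖s‖ < 1 ∧ 2 * |s.im| ≤ τ * (1 - ‖s‖ ^ 2)}

theorem zero_mem_lens {τ : ℝ} (hτ : 0 ≤ τ) : (0 : ℂ) ∈ lens τ :=
  ⟨0, by simp, by simp, by simpa using hτ⟩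

/-- Multiply the square roots s and t. With x = ‖s‖, y = ‖t‖, the bound rests on 1 - x²y² - x(1 -
y²) - y(1 - x²) = (1 - xy)(1 - x)(1 - y) ≥ 0. -/
theorem mul_mem_lens {τ : ℝ} (hτ : 0 ≤ τ) {p q : ℂ} (hp : p ∈ lens τ) (hq : q ∈ lens τ) :
    p * q ∈ lens τ := by
  obtain ⟨s, rfl, hs, hs'⟩ := hp
  obtain ⟨t, rfl, ht, ht'⟩ := hq
  have h0 := norm_nonneg s
  have h0' := norm_nonneg t
  refine ⟨s * t, mul_pow s t 2, ?_, ?_⟩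
  · rw [norm_mul]
    nlinarith
  · have h1 : |(s * t).im| ≤ ‖s‖ * |t.im| + |s.im| * ‖t‖ := by
      rw [Complex.mul_im]
      refine (abs_add_le _ _).trans ?_
      rw [abs_mul, abs_mul]
      gcongr <;> exact Complex.abs_re_le_norm _
    have h2 : 2 * (‖s‖ * |t.im| + |s.im| * ‖t‖) ≤
        τ * (‖s‖ * (1 - ‖t‖ ^ 2) + (1 - ‖s‖ ^ 2) * ‖t‖) := by
      nlinarith [mul_le_mul_of_nonneg_left ht' h0, mul_le_mul_of_nonneg_right hs' h0']
    have h3 : ‖s‖ * (1 - ‖t‖ ^ 2) + (1 - ‖s‖ ^ 2) * ‖t‖ ≤ 1 - (‖s‖ * ‖t‖) ^ 2 := by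
      have : 0 ≤ (1 - ‖s‖ * ‖t‖) * ((1 - ‖s‖) * (1 - ‖t‖)) := by
        refine mul_nonneg ?_ (mul_nonneg ?_ ?_) <;> nlinarith
      nlinarith
    rw [norm_mul]
    linarith [mul_le_mul_of_nonneg_left h3 hτ]

theorem norm_one_sub_sq_sq (s : ℂ) :
    ‖1 - s ^ 2‖ ^ 2 = (1 - ‖s‖ ^ 2) ^ 2 + 4 * s.im ^ 2 := by
  rw [Complex.sq_norm, Complex.sq_norm, Complex.normSq_apply, Complex.normSq_apply]
  simp [pow_two]
  ring

theorem abs_arctan_le (x : ℝ) : |Real.arctan x| ≤ |x| := by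
  have key : ∀ y : ℝ, 0 ≤ y → Real.arctan y ≤ y := fun y hy => by
    have h := Real.le_tan (Real.arctan_nonneg.2 hy) (Real.arctan_lt_pi_div_two y)
    rwa [Real.tan_arctan] at h
  rcases le_total 0 x with hx | hx
  · rw [abs_of_nonneg hx, abs_of_nonneg (Real.arctan_nonneg.2 hx)]
    exact key x hx
  · have := key (-x) (neg_nonneg.2 hx)
    rw [Real.arctan_neg] at this
    rw [abs_of_nonpos hx, abs_of_nonpos]
    · exact this
    · simpa using Real.arctan_mono hx

theorem abs_arg_le_abs_im_div_re {z : ℂ} (hz : 0 < z.re) : |z.arg| ≤ |z.im / z.re| := by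
  have h : |z.arg| < Real.pi / 2 := Complex.abs_arg_lt_pi_div_two_iff.2 (Or.inl hz)
  rw [abs_lt] at h
  rw [← Complex.tan_arg]
  conv_lhs => rw [← Real.arctan_tan h.1 h.2]
  exact abs_arctan_le _

theorem exists_bounds_of_mem_lens {τ c : ℝ} (hτ : 0 ≤ τ) (hc : 0 < c)
    (hcτ : c ^ 2 * (1 + τ ^ 2) = 1) {p : ℂ} (hp : p ∈ lens τ) :
    ∃ a : ℝ, 0 ≤ a ∧ a < 1 ∧ c * ‖1 - p‖ ≤ 1 - a ^ 2 ∧ |(1 - p).arg| ≤ τ * a := by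
  obtain ⟨s, rfl, hs, hs'⟩ := hp
  have h0 := norm_nonneg s
  have hsq : ‖s‖ ^ 2 = s.re ^ 2 + s.im ^ 2 := by
    rw [Complex.sq_norm, Complex.normSq_apply]
    ring
  refine ⟨|s.re|, abs_nonneg _, (Complex.abs_re_le_norm s).trans_lt hs, ?_, ?_⟩
  · rw [sq_abs]
    have h1 : c * ‖1 - s ^ 2‖ ≤ 1 - ‖s‖ ^ 2 := by
      refine abs_le_of_sq_le_sq' ?_ (by nlinarith) |>.2
      rw [mul_pow, norm_one_sub_sq_sq]
      have h2 : (2 * |s.im|) ^ 2 ≤ (τ * (1 - ‖s‖ ^ 2)) ^ 2 :=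
        pow_le_pow_left₀ (by positivity) hs' 2
      rw [mul_pow, sq_abs] at h2
      calc _ ≤ c ^ 2 * ((1 - ‖s‖ ^ 2) ^ 2 + (τ * (1 - ‖s‖ ^ 2)) ^ 2) := by gcongr; linarith
        _ = c ^ 2 * (1 + τ ^ 2) * (1 - ‖s‖ ^ 2) ^ 2 := by ring
        _ = _ := by rw [hcτ, one_mul]
    nlinarith [sq_nonneg s.im]
  · have hre : (1 - s ^ 2).re = 1 - ‖s‖ ^ 2 + 2 * s.im ^ 2 := by
      rw [hsq]
      simp [pow_two]
      ring
    have him : (1 - s ^ 2).im = -(2 * s.re * s.im) := by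
      simp [pow_two]
      ring
    have hs1 : 0 < 1 - ‖s‖ ^ 2 := by nlinarith
    have hpos : 0 < (1 - s ^ 2).re := by
      rw [hre]
      positivity
    refine (abs_arg_le_abs_im_div_re hpos).trans ?_
    rw [abs_div, abs_of_pos hpos, div_le_iff₀ hpos, him, abs_neg, abs_mul, abs_mul, abs_two, hre]
    calc 2 * |s.re| * |s.im| = |s.re| * (2 * |s.im|) := by ring
      _ ≤ |s.re| * (τ * (1 - ‖s‖ ^ 2)) := by gcongr
      _ ≤ τ * |s.re| * (1 - ‖s‖ ^ 2 + 2 * s.im ^ 2) := by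
        nlinarith [mul_nonneg (mul_nonneg hτ (abs_nonneg s.re)) (sq_nonneg s.im)]

/-- For p = R/(1 + R) one has 1 - p = 1/(1 + R), so the lens condition c‖1 - p‖ ≤ 1 - ‖p‖ reads ‖R‖
+ c ≤ ‖1 + R‖. Squaring turns it into the hypothesis. -/
theorem div_one_add_mem_lens {τ c : ℝ} (hτ : 0 ≤ τ) (hc : 0 < c) (hcτ : c ^ 2 * (1 + τ ^ 2) = 1)
    {R : ℂ} (hR : c * ‖R‖ - R.re ≤ (1 - c ^ 2) / 2) : R / (1 + R) ∈ lens τ := by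
  have hN2 : ‖1 + R‖ ^ 2 = 1 + 2 * R.re + ‖R‖ ^ 2 := by
    rw [Complex.sq_norm, Complex.sq_norm, Complex.normSq_apply, Complex.normSq_apply]
    simp
    ring
  have hr := norm_nonneg R
  have hN : ‖R‖ + c ≤ ‖1 + R‖ := by
    refine abs_le_of_sq_le_sq' ?_ (norm_nonneg _) |>.2
    rw [hN2]
    nlinarith
  have hNpos : 0 < ‖1 + R‖ := by linarith
  have hne : 1 + R ≠ 0 := norm_pos_iff.1 hNpos
  obtain ⟨s, hs⟩ := IsAlgClosed.exists_pow_nat_eq (R / (1 + R)) two_pos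
  have hs2 : ‖s‖ ^ 2 = ‖R‖ / ‖1 + R‖ := by rw [← norm_pow, hs, norm_div]
  have h1 : 1 - ‖s‖ ^ 2 = (‖1 + R‖ - ‖R‖) / ‖1 + R‖ := by
    rw [hs2]
    field_simp
  have hlt : 0 < 1 - ‖s‖ ^ 2 := by
    rw [h1]
    exact div_pos (by linarith) hNpos
  refine ⟨s, hs, by nlinarith [norm_nonneg s], ?_⟩
  refine abs_le_of_sq_le_sq' ?_ (by positivity) |>.2
  have h2 := norm_one_sub_sq_sq s
  have h3 : ‖1 - s ^ 2‖ = 1 / ‖1 + R‖ := by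
    rw [hs, show 1 - R / (1 + R) = 1 / (1 + R) by field_simp; ring, norm_div, norm_one]
  have h4 : (2 * |s.im|) ^ 2 = ‖1 - s ^ 2‖ ^ 2 - (1 - ‖s‖ ^ 2) ^ 2 := by
    rw [h2, mul_pow, sq_abs]
    ring
  have h5 : ‖1 - s ^ 2‖ ^ 2 ≤ (1 + τ ^ 2) * (1 - ‖s‖ ^ 2) ^ 2 := by
    rw [h3, h1, div_pow, div_pow, ← mul_div_assoc, one_pow]
    gcongr
    have : c ^ 2 ≤ (‖1 + R‖ - ‖R‖) ^ 2 := pow_le_pow_left₀ hc.le (by linarith) 2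
    nlinarith [sq_nonneg τ]
  rw [h4, mul_pow]
  linarith

/-! ### The extremal inequality behind the critical value -/

open Finset in
-- Apply t ≤ exp(t - 1) to each b(1 - x i) and to z; the exponents cancel. Equality holds when `#s =
-- d` and every x i = 1/d. Missing indices act as x i = 0 and are paid for by b ≤ exp(1/(d - 1)).
theorem prod_one_sub_mul_le {ι : Type*} {s : Finset ι} {x : ι → ℝ} {d : ℕ} (hd : 2 ≤ d)
    (hs : #s ≤ d) (hx : ∀ i ∈ s, x i ≤ 1) :
    (∏ i ∈ s, (1 - x i)) * (d * ∑ i ∈ s, x i - 1) ≤ ((d : ℝ) - 1) ^ (d + 1) / d ^ d := by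
  have hd1 : (0 : ℝ) < d - 1 := by
    have : (2 : ℝ) ≤ d := by exact_mod_cast hd
    linarith
  have hd0 : (0 : ℝ) < d := by linarith
  set b : ℝ := d / (d - 1) with hb
  have hbpos : 0 < b := div_pos hd0 hd1
  have hble : b ≤ Real.exp (1 / (d - 1)) := by
    have := Real.add_one_le_exp (1 / ((d : ℝ) - 1))
    rwa [show 1 / ((d : ℝ) - 1) + 1 = b by rw [hb]; field_simp; ring] at this
  have hprod0 : 0 ≤ ∏ i ∈ s, (1 - x i) := prod_nonneg fun i hi => sub_nonneg.2 (hx i hi)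
  have hP : b ^ #s * ∏ i ∈ s, (1 - x i) ≤ Real.exp (∑ i ∈ s, (b * (1 - x i) - 1)) := by
    rw [← prod_const, ← prod_mul_distrib, Real.exp_sum]
    refine prod_le_prod (fun i hi => mul_nonneg hbpos.le (sub_nonneg.2 (hx i hi))) fun i _ => ?_
    simpa using Real.add_one_le_exp (b * (1 - x i) - 1)
  have hB : b ^ (d - #s) ≤ Real.exp ((d - #s : ℝ) * (1 / (d - 1))) := by
    rw [← Nat.cast_sub hs, Real.exp_nat_mul]
    exact pow_le_pow_left₀ hbpos.le hble _
  set z : ℝ := (d * ∑ i ∈ s, x i - 1) / (d - 1) with hz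
  have hZ : z ≤ Real.exp (z - 1) := by simpa using Real.add_one_le_exp (z - 1)
  have hsum : (∑ i ∈ s, (b * (1 - x i) - 1)) + (d - #s : ℝ) * (1 / (d - 1)) + (z - 1) = 0 := by
    rw [sum_sub_distrib, ← mul_sum, sum_sub_distrib]
    simp only [sum_const, nsmul_eq_mul, mul_one, hz, hb]
    field_simp
    ring
  have hall : b ^ d * (∏ i ∈ s, (1 - x i)) * z ≤ 1 := by
    have h1 : b ^ d * ∏ i ∈ s, (1 - x i) ≤ Real.exp (-(z - 1)) := by
      calc b ^ d * ∏ i ∈ s, (1 - x i)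
          = (b ^ #s * ∏ i ∈ s, (1 - x i)) * b ^ (d - #s) := by
            rw [← Nat.add_sub_cancel' hs, pow_add, Nat.add_sub_cancel' hs]
            ring
        _ ≤ Real.exp (∑ i ∈ s, (b * (1 - x i) - 1)) *
            Real.exp ((d - #s : ℝ) * (1 / (d - 1))) := by gcongr
        _ = _ := by
          rw [← Real.exp_add]
          congr 1
          linarith
    calc _ ≤ b ^ d * (∏ i ∈ s, (1 - x i)) * Real.exp (z - 1) := by gcongr
      _ ≤ Real.exp (-(z - 1)) * Real.exp (z - 1) := by gcongr
      _ = 1 := by rw [← Real.exp_add]; simp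
  have hfin : (∏ i ∈ s, (1 - x i)) * z ≤ ((d : ℝ) - 1) ^ d / d ^ d := by
    rw [mul_assoc, hb, div_pow, div_mul_eq_mul_div, div_le_one (by positivity)] at hall
    rw [le_div_iff₀ (by positivity)]
    linarith
  calc _ = (∏ i ∈ s, (1 - x i)) * z * (d - 1) := by rw [hz]; field_simp
    _ ≤ ((d : ℝ) - 1) ^ d / d ^ d * (d - 1) := by gcongr
    _ = _ := by rw [pow_succ]; ring

open Finset in
theorem sq_sum_mul_prod_le {ι : Type*} {s : Finset ι} {a : ι → ℝ} {d : ℕ} (hd : 2 ≤ d)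
    (hs : #s ≤ d) (ha : ∀ i ∈ s, a i ^ 2 ≤ 1) {μ θ : ℝ} (hμ : 0 ≤ μ)
    (hμθ : μ * (((d : ℝ) - 1) ^ (d + 1) / d ^ d) ≤ θ) (hθ : θ ≤ 1) :
    (∑ i ∈ s, a i) ^ 2 * (μ * ∏ i ∈ s, (1 - a i ^ 2)) ≤
      (θ + μ) / (1 + μ) * (1 + μ * ∏ i ∈ s, (1 - a i ^ 2)) := by
  have hpos : 0 ≤ ∏ i ∈ s, (1 - a i ^ 2) := prod_nonneg fun i hi => sub_nonneg.2 (ha i hi)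
  have hle : ∏ i ∈ s, (1 - a i ^ 2) ≤ 1 :=
    prod_le_one (fun i hi => sub_nonneg.2 (ha i hi)) fun i _ => by linarith [sq_nonneg (a i)]
  have hQ : 0 ≤ ∑ i ∈ s, a i ^ 2 := sum_nonneg fun i _ => sq_nonneg _
  have hcs : (∑ i ∈ s, a i) ^ 2 ≤ d * ∑ i ∈ s, a i ^ 2 :=
    sq_sum_le_card_mul_sum_sq.trans
      (mul_le_mul_of_nonneg_right (by exact_mod_cast hs) hQ)
  have h1 := mul_le_mul_of_nonneg_left (prod_one_sub_mul_le (x := fun i => a i ^ 2) hd hs ha) hμ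
  set X := ∏ i ∈ s, (1 - a i ^ 2)
  have hX : 0 ≤ μ * X := mul_nonneg hμ hpos
  have hX' : μ * X ≤ μ := mul_le_of_le_one_right hμ hle
  calc _ ≤ (d * ∑ i ∈ s, a i ^ 2) * (μ * X) := by gcongr
    _ ≤ θ + μ * X := by nlinarith
    -- As θ ≤ 1, (θ + t)/(1 + t) is nondecreasing in t, so its value at t = μ is the worst.
    _ ≤ _ := by
      rw [div_mul_eq_mul_div, le_div_iff₀ (by linarith)]
      nlinarith [mul_nonneg (sub_nonneg.2 hθ) (sub_nonneg.2 hX')]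

/-! ### Deletion and contraction -/

open Finset in
/-- The independence polynomial of the hypergraph with vertices `V` and edges `E`. -/
noncomputable def indepSum {α : Type*} [DecidableEq α] (lam : ℂ) (V : Finset α)
    (E : Finset (Finset α)) : ℂ :=
  ∑ I ∈ V.powerset with ∀ e ∈ E, ¬ e ⊆ I, lam ^ #I

/-- The edges that remain when the vertices of `f` are contracted. -/
def contractEdges {α : Type*} [DecidableEq α] (E : Finset (Finset α)) (f : Finset α) :
    Finset (Finset α) :=
  E.image (· \ f)

namespace Hypergraph

open Finset

variable {α : Type*} [DecidableEq α] {lam : ℂ} {V : Finset α} {E : Finset (Finset α)}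

theorem sdiff_singleton_eq_self_of_notMem {s : Finset α} {a : α} (h : a ∉ s) : s \ {a} = s :=
  sdiff_eq_self_of_disjoint (disjoint_singleton_right.2 h)

theorem indepSum_eq_zero (h : ∅ ∈ E) : indepSum lam V E = 0 := by
  rw [indepSum, filter_false_of_mem, sum_empty]
  exact fun I _ hI => hI ∅ h (empty_subset I)

theorem indepSum_empty (h : ∅ ∉ E) : indepSum lam ∅ E = 1 := by
  simp [indepSum, filter_singleton, subset_empty, h]

theorem sum_indep_superset {f : Finset α} (hf : f ⊆ V) :
    (∑ I ∈ V.powerset with (∀ e ∈ E, ¬ e ⊆ I) ∧ f ⊆ I, lam ^ #I) =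
      lam ^ #f * indepSum lam (V \ f) (contractEdges E f) := by
  rw [indepSum, mul_sum]
  symm
  refine sum_bij (fun J _ => J ∪ f) ?_ ?_ ?_ ?_
  · intro J hJ
    simp only [mem_filter, mem_powerset, contractEdges, forall_mem_image] at hJ ⊢
    refine ⟨union_subset (hJ.1.trans sdiff_subset) hf, fun e he h => hJ.2 he ?_,
      subset_union_right⟩
    exact sdiff_le_iff.2 (h.trans (union_comm J f).subset)
  · intro J hJ K hK h
    simp only [mem_filter, mem_powerset, subset_sdiff] at hJ hK
    rw [← union_sdiff_cancel_right hJ.1.2, h, union_sdiff_cancel_right hK.1.2]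
  · intro I hI
    simp only [mem_filter, mem_powerset] at hI
    refine ⟨I \ f, ?_, sdiff_union_of_subset hI.2.2⟩
    simp only [mem_filter, mem_powerset, contractEdges, forall_mem_image]
    refine ⟨sdiff_subset_sdiff hI.1 le_rfl, fun e he h => hI.2.1 e he ?_⟩
    exact (sdiff_le_iff.1 h).trans (union_sdiff_of_subset hI.2.2).subset
  · intro J hJ
    simp only [mem_filter, mem_powerset, subset_sdiff] at hJ
    rw [card_union_of_disjoint hJ.1.2, pow_add, mul_comm]

theorem indepSum_insert {f : Finset α} (hf : f ⊆ V) :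
    indepSum lam V (insert f E) =
      indepSum lam V E - lam ^ #f * indepSum lam (V \ f) (contractEdges E f) := by
  rw [← sum_indep_superset hf, eq_sub_iff_add_eq, indepSum, indepSum,
    ← sum_filter_add_sum_filter_not (V.powerset.filter fun I => ∀ e ∈ E, ¬ e ⊆ I) (f ⊆ ·),
    add_comm, filter_filter, filter_filter]
  simp only [forall_mem_insert, and_comm]

theorem indepSum_eq_add {v : α} (hv : v ∈ V) :
    indepSum lam V E = indepSum lam (V \ {v}) (E.filter (v ∉ ·)) +
      lam * indepSum lam (V \ {v}) (contractEdges E {v}) := by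
  have h := sum_indep_superset (lam := lam) (E := E) (singleton_subset_iff.2 hv)
  rw [card_singleton, pow_one] at h
  rw [← h, indepSum, indepSum,
    ← sum_filter_add_sum_filter_not (V.powerset.filter fun I => ∀ e ∈ E, ¬ e ⊆ I) ({v} ⊆ ·),
    add_comm, filter_filter, filter_filter]
  congr 1
  refine sum_congr ?_ fun _ _ => rfl
  ext I
  simp only [mem_filter, mem_powerset, subset_sdiff, disjoint_singleton_right,
    singleton_subset_iff]
  constructor
  · rintro ⟨h1, h2, h3⟩
    exact ⟨⟨h1, h3⟩, fun e he => h2 e he.1⟩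
  · rintro ⟨⟨h1, h3⟩, h2⟩
    exact ⟨h1, fun e he h => h2 e ⟨he, fun hve => h3 (h hve)⟩ h, h3⟩

theorem contractEdges_contractEdges (f g : Finset α) :
    contractEdges (contractEdges E f) g = contractEdges E (f ∪ g) := by
  simp only [contractEdges, Finset.image_image, Function.comp_def, sdiff_sdiff, sup_eq_union]

/-- The number of edges that contain `v`. -/
def edgeDegree (E : Finset (Finset α)) (v : α) : ℕ := #{e ∈ E | v ∈ e}

theorem edgeDegree_mono {E' : Finset (Finset α)} (h : E' ⊆ E) (v : α) :
    edgeDegree E' v ≤ edgeDegree E v :=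
  card_le_card (filter_subset_filter _ h)

theorem edgeDegree_contractEdges_le (f : Finset α) (v : α) :
    edgeDegree (contractEdges E f) v ≤ edgeDegree E v := by
  refine (card_le_card ?_).trans (card_image_le (f := (· \ f)))
  intro e he
  simp only [contractEdges, mem_filter, mem_image] at he ⊢
  obtain ⟨⟨e', he', rfl⟩, h⟩ := he
  exact ⟨e', ⟨he', (mem_sdiff.1 h).1⟩, rfl⟩

/-- `E` is a set of nonempty edges on the vertex set `V` with maximum degree at most `D`. -/
structure IsBounded (D : ℕ) (V : Finset α) (E : Finset (Finset α)) : Prop where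
  empty_notMem : ∅ ∉ E
  subset : ∀ e ∈ E, e ⊆ V
  degree_le : ∀ v, edgeDegree E v ≤ D

theorem IsBounded.contractEdges {D : ℕ} (h : IsBounded D V E) {f : Finset α}
    (hf : ∅ ∉ contractEdges E f) : IsBounded D (V \ f) (contractEdges E f) where
  empty_notMem := hf
  subset := by
    simp only [_root_.contractEdges, forall_mem_image]
    exact fun e he => sdiff_subset_sdiff (h.subset e he) le_rfl
  degree_le v := (edgeDegree_contractEdges_le f v).trans (h.degree_le v)

theorem IsBounded.of_subset_contractEdges {D : ℕ} (h : IsBounded D V E) {f : Finset α}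
    (hf : ∅ ∉ _root_.contractEdges E f) {E' : Finset (Finset α)}
    (hE' : E' ⊆ _root_.contractEdges E f) : IsBounded D (V \ f) E' where
  empty_notMem h' := hf (hE' h')
  subset e he := (h.contractEdges hf).subset e (hE' he)
  degree_le v := (edgeDegree_mono hE' v).trans ((h.contractEdges hf).degree_le v)

/-! ### Induction on the vertex set -/

/-- Every edge set of maximum degree at most `d + 1` on `V` has nonzero independence polynomial,
and the complex probability that a random independent set contains a nonempty set `f` of vertices
of degree at most `d` lies in `P`. -/
def IsZeroFree (P : Set ℂ) (d : ℕ) (lam : ℂ) (V : Finset α) : Prop :=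
  ∀ E, IsBounded (d + 1) V E → indepSum lam V E ≠ 0 ∧
    ∀ f ⊆ V, f.Nonempty → (∀ u ∈ f, edgeDegree E u ≤ d) →
      lam ^ #f * indepSum lam (V \ f) (contractEdges E f) / indepSum lam V E ∈ P

theorem indepSum_link {P : Set ℂ} {d : ℕ} {v : α} (h0 : (0 : ℂ) ∈ P)
    (hS : IsZeroFree P d lam (V \ {v})) (hE : IsBounded (d + 1) V E)
    (hv : ∅ ∉ contractEdges E {v}) {T : Finset (Finset α)} (hT : T ⊆ {e ∈ E | v ∈ e}) :
    ∃ p : Finset α → ℂ, (∀ e, p e ∈ P) ∧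
      indepSum lam (V \ {v}) ({e ∈ E | v ∉ e} ∪ contractEdges T {v}) =
        indepSum lam (V \ {v}) {e ∈ E | v ∉ e} * ∏ e ∈ T, (1 - p e) := by
  induction T using Finset.induction_on with
  | empty => exact ⟨fun _ => 0, fun _ => h0, by simp [contractEdges]⟩
  | insert e T heT ih =>
    obtain ⟨p, hp, hprod⟩ := ih ((subset_insert e T).trans hT)
    rw [insert_subset_iff, mem_filter] at hT
    obtain ⟨⟨he, hve⟩, hT⟩ := hT
    set F := {e ∈ E | v ∉ e} ∪ contractEdges T {v} with hF
    have hFE : F ⊆ contractEdges E {v} := by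
      refine union_subset (fun g hg => ?_) (image_subset_image (hT.trans (filter_subset _ _)))
      rw [mem_filter] at hg
      exact mem_image.2 ⟨g, hg.1, sdiff_singleton_eq_self_of_notMem hg.2⟩
    have hFb := hE.of_subset_contractEdges hv hFE
    have hef : e \ {v} ⊆ V \ {v} := sdiff_subset_sdiff (hE.subset e he) le_rfl
    have hne : (e \ {v}).Nonempty := by
      rw [nonempty_iff_ne_empty]
      exact fun h => hv (mem_image.2 ⟨e, he, h⟩)
    have hdeg : ∀ u ∈ e \ {v}, edgeDegree F u ≤ d := by
      intro u hu
      have huv := mem_sdiff.1 hu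
      -- The edge e has not been restored yet, so u has lost one of its at most d + 1 edges. This is
      -- where the bound d comes from.
      have hle : edgeDegree F u ≤ #({g ∈ E | u ∈ g}.erase e) := by
        have hsub : {g ∈ F | u ∈ g} ⊆ ({g ∈ E | u ∈ g}.erase e).image (· \ {v}) := by
          intro g hg
          simp only [hF, mem_filter, mem_union, contractEdges, mem_image] at hg
          simp only [mem_image, mem_erase, mem_filter]
          obtain ⟨⟨h1, h2⟩ | ⟨g', h1, rfl⟩, h3⟩ := hg
          · exact ⟨g, ⟨fun h => h2 (h ▸ hve), h1, h3⟩, sdiff_singleton_eq_self_of_notMem h2⟩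
          · exact ⟨g', ⟨fun h => heT (h ▸ h1), (mem_filter.1 (hT h1)).1, (mem_sdiff.1 h3).1⟩, rfl⟩
        exact (card_le_card hsub).trans card_image_le
      have hmem : e ∈ {g ∈ E | u ∈ g} := mem_filter.2 ⟨he, huv.1⟩
      have := hE.degree_le u
      rw [edgeDegree] at this
      rw [card_erase_of_mem hmem] at hle
      omega
    obtain ⟨hZ, hP⟩ := hS F hFb
    refine ⟨Function.update p e (lam ^ #(e \ {v}) * indepSum lam ((V \ {v}) \ (e \ {v}))
      (contractEdges F (e \ {v})) / indepSum lam (V \ {v}) F), fun g => ?_, ?_⟩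
    rotate_right
    · rw [show {e ∈ E | v ∉ e} ∪ contractEdges (insert e T) {v} = insert (e \ {v}) F by
        rw [hF, contractEdges, contractEdges, image_insert, union_insert],
        indepSum_insert hef, prod_insert heT, Function.update_self,
        prod_congr rfl (g := fun g => 1 - p g) fun g hg => by
          rw [Function.update_of_ne (ne_of_mem_of_not_mem hg heT)],
        mul_left_comm, ← hprod, sub_mul, one_mul, div_mul_cancel₀ _ hZ]
    · rcases eq_or_ne g e with rfl | hg
      · rw [Function.update_self]
        exact hP _ hef hne hdeg
      · rw [Function.update_of_ne hg]
        exact hp g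

theorem indepSum_star {P : Set ℂ} {d : ℕ} {v : α} (h0 : (0 : ℂ) ∈ P)
    (hS : IsZeroFree P d lam (V \ {v})) (hE : IsBounded (d + 1) V E)
    (hv : ∅ ∉ contractEdges E {v}) :
    ∃ p : Finset α → ℂ, (∀ e, p e ∈ P) ∧
      indepSum lam (V \ {v}) (contractEdges E {v}) =
        indepSum lam (V \ {v}) {e ∈ E | v ∉ e} * ∏ e ∈ E with v ∈ e, (1 - p e) := by
  obtain ⟨p, hp, h⟩ := indepSum_link h0 hS hE hv Subset.rfl
  refine ⟨p, hp, ?_⟩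
  rw [← h]
  congr 1
  have h1 : contractEdges {e ∈ E | v ∉ e} {v} = {e ∈ E | v ∉ e} := by
    rw [contractEdges]
    conv_rhs => rw [← image_id (s := {e ∈ E | v ∉ e})]
    exact image_congr fun e he => sdiff_singleton_eq_self_of_notMem (mem_filter.1 (mem_coe.1 he)).2
  conv_rhs => rw [← h1]
  rw [contractEdges, contractEdges, contractEdges, ← image_union, union_comm,
    filter_union_filter_not_eq]

theorem IsBounded.filter_notMem {D : ℕ} (h : IsBounded D V E) (v : α) :
    IsBounded D (V \ {v}) {e ∈ E | v ∉ e} where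
  empty_notMem h' := h.empty_notMem (mem_filter.1 h').1
  subset e he := by
    rw [mem_filter] at he
    rw [subset_sdiff, disjoint_singleton_right]
    exact ⟨h.subset e he.1, he.2⟩
  degree_le v := (edgeDegree_mono (filter_subset _ _) v).trans (h.degree_le v)

theorem isZeroFree {P : Set ℂ} {d : ℕ} (h0 : (0 : ℂ) ∈ P)
    (hmul : ∀ p ∈ P, ∀ q ∈ P, p * q ∈ P)
    (hstep : ∀ (s : Finset (Finset α)) (p : Finset α → ℂ), #s ≤ d → (∀ i, p i ∈ P) →
      (lam * ∏ i ∈ s, (1 - p i)) / (1 + lam * ∏ i ∈ s, (1 - p i)) ∈ P)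
    (hroot : ∀ (s : Finset (Finset α)) (p : Finset α → ℂ), #s ≤ d + 1 → (∀ i, p i ∈ P) →
      1 + lam * ∏ i ∈ s, (1 - p i) ≠ 0) (V : Finset α) :
    IsZeroFree P d lam V := by
  induction V using Finset.strongInduction with
  | H V ih =>
  have ihv : ∀ v ∈ V, IsZeroFree P d lam (V \ {v}) := fun v hv =>
    ih _ (sdiff_ssubset (singleton_subset_iff.2 hv) (singleton_nonempty v))
  intro E hE
  have hne : indepSum lam V E ≠ 0 := by
    rcases V.eq_empty_or_nonempty with rfl | ⟨v, hv⟩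
    · rw [indepSum_empty hE.empty_notMem]
      exact one_ne_zero
    · have hZ := (ihv v hv _ (hE.filter_notMem v)).1
      rw [indepSum_eq_add hv]
      by_cases hc : ∅ ∈ contractEdges E {v}
      · rwa [indepSum_eq_zero hc, mul_zero, add_zero]
      · obtain ⟨p, hp, h⟩ := indepSum_star h0 (ihv v hv) hE hc
        rw [h, mul_left_comm, ← mul_one_add]
        exact mul_ne_zero hZ (hroot _ p (hE.degree_le v) hp)
  refine ⟨hne, fun f hf hfne hdeg => ?_⟩
  obtain ⟨u, hu⟩ := hfne
  have huV := hf hu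
  by_cases hc : ∅ ∈ contractEdges E {u}
  -- Here some edge lies inside {u}, so no independent set contains f and the probability is 0.
  · have hc' : ∅ ∈ contractEdges E f := by
      obtain ⟨e, he, h⟩ := mem_image.1 hc
      refine mem_image.2 ⟨e, he, ?_⟩
      rw [sdiff_eq_empty_iff_subset] at h ⊢
      exact h.trans (singleton_subset_iff.2 hu)
    rwa [indepSum_eq_zero hc', mul_zero, zero_div]
  obtain ⟨hZu, hPu⟩ := ihv u huV _ (hE.contractEdges hc)
  have hu1 : lam * indepSum lam (V \ {u}) (contractEdges E {u}) / indepSum lam V E ∈ P := by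
    obtain ⟨p, hp, h⟩ := indepSum_star h0 (ihv u huV) hE hc
    have hZ := (ihv u huV _ (hE.filter_notMem u)).1
    have := hstep _ p (hdeg u hu) hp
    rwa [indepSum_eq_add huV, h, mul_left_comm, ← mul_one_add, mul_div_mul_left _ _ hZ]
  by_cases hfu : f = {u}
  · rwa [hfu, card_singleton, pow_one]
  have hne' : (f \ {u}).Nonempty := by
    rw [nonempty_iff_ne_empty, Ne, sdiff_eq_empty_iff_subset, subset_singleton_iff]
    rintro (h | h)
    · simp [h] at hu
    · exact hfu h
  have h2 := hPu (f \ {u}) (sdiff_subset_sdiff hf le_rfl) hne' fun w hw =>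
    (edgeDegree_contractEdges_le _ _).trans (hdeg w (mem_sdiff.1 hw).1)
  have hun : {u} ∪ f \ {u} = f := union_sdiff_of_subset (singleton_subset_iff.2 hu)
  rw [contractEdges_contractEdges, sdiff_sdiff, sup_eq_union, hun] at h2
  have hcard : #f = 1 + #(f \ {u}) := by
    rw [← card_singleton u, ← card_union_of_disjoint disjoint_sdiff, hun]
  -- Chain rule: P(f ⊆ I) is P(u ∈ I) times the probability of f \ {u} after contracting u.
  convert hmul _ hu1 _ h2 using 1
  rw [hcard]
  field_simp
  ring

end Hypergraph

/-! ### Stability of the lens under the recursion -/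

open Finset in
theorem exists_polar_of_mem_lens {ι : Type*} {τ c : ℝ} (hτ : 0 ≤ τ) (hc : 0 < c)
    (hcτ : c ^ 2 * (1 + τ ^ 2) = 1) {p : ι → ℂ} (hp : ∀ i, p i ∈ lens τ) (lam : ℂ)
    (s : Finset ι) :
    ∃ a : ι → ℝ, ∃ φ : ℝ, (∀ i, 0 ≤ a i ∧ a i < 1) ∧ |φ| ≤ |lam.arg| + τ * ∑ i ∈ s, a i ∧
      c ^ #s * ‖lam * ∏ i ∈ s, (1 - p i)‖ ≤ ‖lam‖ * ∏ i ∈ s, (1 - a i ^ 2) ∧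
      (lam * ∏ i ∈ s, (1 - p i)).re = ‖lam * ∏ i ∈ s, (1 - p i)‖ * Real.cos φ := by
  choose a ha0 ha1 hnorm harg using fun i => exists_bounds_of_mem_lens hτ hc hcτ (hp i)
  refine ⟨a, lam.arg + ∑ i ∈ s, (1 - p i).arg, fun i => ⟨ha0 i, ha1 i⟩, ?_, ?_, ?_⟩
  · refine (abs_add_le _ _).trans (add_le_add le_rfl ((abs_sum_le_sum_abs _ _).trans ?_))
    rw [mul_sum]
    exact sum_le_sum fun i _ => harg i
  · rw [norm_mul, norm_prod, mul_left_comm, ← prod_const, ← prod_mul_distrib]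
    gcongr with i hi
    exact hnorm i
  · have h : lam * ∏ i ∈ s, (1 - p i) = ((‖lam * ∏ i ∈ s, (1 - p i)‖ : ℝ) : ℂ) *
        Complex.exp (((lam.arg + ∑ i ∈ s, (1 - p i).arg : ℝ) : ℂ) * Complex.I) := by
      rw [norm_mul, norm_prod]
      push_cast
      rw [add_mul, Complex.exp_add, sum_mul, Complex.exp_sum, mul_mul_mul_comm,
        Complex.norm_mul_exp_arg_mul_I, ← prod_mul_distrib]
      simp only [Complex.norm_mul_exp_arg_mul_I]
    conv_lhs => rw [h]
    rw [Complex.re_ofReal_mul, Complex.exp_ofReal_mul_I_re]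

open Finset in
theorem div_one_add_prod_mem_lens {ι : Type*} {τ c η κ μ θ : ℝ} {d : ℕ} (hτ : 0 ≤ τ) (hc : 0 < c)
    (hcτ : c ^ 2 * (1 + τ ^ 2) = 1) (hd : 2 ≤ d) (hμ : 0 ≤ μ) (hη : 0 ≤ η)
    (hμθ : μ * (((d : ℝ) - 1) ^ (d + 1) / d ^ d) ≤ θ) (hθ : θ ≤ 1) (hκ : κ = (θ + μ) / (1 + μ))
    (hκc : κ + η ^ 2 + 2 * η * d ≤ c ^ 2) {lam : ℂ} (hlam : ‖lam‖ ≤ c ^ d * μ)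
    (harg : |lam.arg| ≤ τ * η) {p : ι → ℂ} (hp : ∀ i, p i ∈ lens τ) {s : Finset ι} (hs : #s ≤ d) :
    (lam * ∏ i ∈ s, (1 - p i)) / (1 + lam * ∏ i ∈ s, (1 - p i)) ∈ lens τ := by
  obtain ⟨a, φ, ha, hφ, hnorm, hre⟩ := exists_polar_of_mem_lens hτ hc hcτ hp lam s
  refine div_one_add_mem_lens hτ hc hcτ ?_
  rw [hre]
  have ha2 : ∀ i ∈ s, a i ^ 2 ≤ 1 := fun i _ => pow_le_one₀ (ha i).1 (ha i).2.le
  have hX := sq_sum_mul_prod_le hd hs ha2 hμ hμθ hθ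
  have hA0 : 0 ≤ ∑ i ∈ s, a i := sum_nonneg fun i _ => (ha i).1
  have hAd : ∑ i ∈ s, a i ≤ d := by
    refine (sum_le_card_nsmul s a 1 fun i _ => (ha i).2.le).trans ?_
    rw [nsmul_one]
    exact_mod_cast hs
  have hpos : 0 ≤ ∏ i ∈ s, (1 - a i ^ 2) := prod_nonneg fun i hi => sub_nonneg.2 (ha2 i hi)
  have hc1 : c ≤ 1 := by nlinarith [mul_nonneg (sq_nonneg c) (sq_nonneg τ)]
  rw [← hκ] at hX
  have hr := norm_nonneg (lam * ∏ i ∈ s, (1 - p i))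
  set r := ‖lam * ∏ i ∈ s, (1 - p i)‖
  set A := ∑ i ∈ s, a i
  have hrX : r ≤ μ * ∏ i ∈ s, (1 - a i ^ 2) := by
    have h1 : c ^ d * r ≤ c ^ d * (μ * ∏ i ∈ s, (1 - a i ^ 2)) := by
      calc c ^ d * r ≤ c ^ #s * r :=
            mul_le_mul_of_nonneg_right (pow_le_pow_of_le_one hc.le hc1 hs) hr
        _ ≤ _ := hnorm
        _ ≤ _ := by
          rw [← mul_assoc]
          gcongr
    exact le_of_mul_le_mul_left h1 (by positivity)
  set X := μ * ∏ i ∈ s, (1 - a i ^ 2)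
  have hdiv : 0 ≤ 1 + X := by linarith
  -- The claim is (A² - κ)r ≤ κ: trivial if A² ≤ κ, otherwise monotone in r and known at X ≥ r.
  have hAr : A ^ 2 * r ≤ κ * (1 + r) := by
    rcases le_total (A ^ 2) κ with h | h
    · nlinarith [sq_nonneg A]
    · nlinarith [mul_le_mul_of_nonneg_left hrX (sub_nonneg.2 h)]
  have hAη : (η + A) ^ 2 * r ≤ c ^ 2 * (1 + r) := by
    have h1 : (η ^ 2 + 2 * η * A) * r ≤ (η ^ 2 + 2 * η * d) * (1 + r) := by
      gcongr
      linarith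
    nlinarith
  have hφ2 : φ ^ 2 ≤ (τ * (η + A)) ^ 2 := by
    rw [← sq_abs φ]
    exact pow_le_pow_left₀ (abs_nonneg _) (by linarith) 2
  have hφr : φ ^ 2 * r ≤ c ^ 2 * τ ^ 2 * (1 + r) := by
    calc φ ^ 2 * r ≤ (τ * (η + A)) ^ 2 * r := by gcongr
      _ = τ ^ 2 * ((η + A) ^ 2 * r) := by ring
      _ ≤ τ ^ 2 * (c ^ 2 * (1 + r)) := by gcongr
      _ = _ := by ring
  have hcos := mul_le_mul_of_nonneg_left (Real.one_sub_sq_div_two_le_cos (x := φ)) hr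
  have hcτ' : c ^ 2 * τ ^ 2 = 1 - c ^ 2 := by linarith
  rw [hcτ'] at hφr
  -- The bounds leave exactly the surplus r(1 - c)²/2.
  nlinarith [mul_nonneg hr (sq_nonneg (1 - c))]

open Finset in
-- Only arguments matter: the total argument is at most 1 < π/2, so the product has nonnegative real
-- part.
theorem one_add_prod_ne_zero {ι : Type*} {τ c η : ℝ} {d : ℕ} (hτ : 0 ≤ τ) (hc : 0 < c)
    (hcτ : c ^ 2 * (1 + τ ^ 2) = 1) (hτd : τ * (η + d) ≤ 1) {lam : ℂ}
    (harg : |lam.arg| ≤ τ * η) {p : ι → ℂ} (hp : ∀ i, p i ∈ lens τ) {s : Finset ι} (hs : #s ≤ d) :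
    1 + lam * ∏ i ∈ s, (1 - p i) ≠ 0 := by
  obtain ⟨a, φ, ha, hφ, -, hre⟩ := exists_polar_of_mem_lens hτ hc hcτ hp lam s
  have hAd : ∑ i ∈ s, a i ≤ d := by
    refine (sum_le_card_nsmul s a 1 fun i _ => (ha i).2.le).trans ?_
    rw [nsmul_one]
    exact_mod_cast hs
  have hφ1 : |φ| ≤ 1 := by nlinarith [mul_le_mul_of_nonneg_left hAd hτ]
  have hcos : 0 ≤ Real.cos φ := by
    have h := Real.one_sub_sq_div_two_le_cos (x := φ)
    have : φ ^ 2 ≤ 1 := by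
      rw [← sq_abs]
      exact pow_le_one₀ (abs_nonneg _) hφ1
    linarith
  intro h
  have h' := congrArg Complex.re h
  rw [Complex.add_re, hre, Complex.one_re, Complex.zero_re] at h'
  linarith [mul_nonneg (norm_nonneg (lam * ∏ i ∈ s, (1 - p i))) hcos]

open Filter Topology in
/-- Near a real fugacity below the critical value, some lens is stable under the recursion for the
occupation probabilities. -/
theorem exists_lens_stable {d : ℕ} (hd : 2 ≤ d) {x : ℝ} (hx : 0 < x)
    (hxc : x < (d : ℝ) ^ d / ((d : ℝ) - 1) ^ (d + 1)) :
    ∃ τ : ℝ, 0 ≤ τ ∧ ∀ᶠ lam in 𝓝 (x : ℂ),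
      ∀ (ι : Type*) (s : Finset ι) (p : ι → ℂ), (∀ i, p i ∈ lens τ) →
        (s.card ≤ d →
          (lam * ∏ i ∈ s, (1 - p i)) / (1 + lam * ∏ i ∈ s, (1 - p i)) ∈ lens τ) ∧
        (s.card ≤ d + 1 → 1 + lam * ∏ i ∈ s, (1 - p i) ≠ 0) := by
  have hd1 : (0 : ℝ) < d - 1 := by
    have : (2 : ℝ) ≤ d := by exact_mod_cast hd
    linarith
  have hd0 : (0 : ℝ) < d := by linarith
  obtain ⟨μ, hxμ, hμc⟩ := exists_between hxc
  have hμ : 0 < μ := hx.trans hxμ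
  set θ : ℝ := μ * (((d : ℝ) - 1) ^ (d + 1) / d ^ d) with hθ
  have hθ1 : θ < 1 := by
    rw [lt_div_iff₀ (by positivity)] at hμc
    rwa [hθ, ← mul_div_assoc, div_lt_one (by positivity)]
  have hθ0 : 0 ≤ θ := by positivity
  set κ : ℝ := (θ + μ) / (1 + μ) with hκ
  have hκ1 : κ < 1 := by
    rw [hκ, div_lt_one (by linarith)]
    linarith
  have hκ0 : 0 ≤ κ := by positivity
  -- Since η ≤ 1, η² + 2ηd ≤ η(1 + 2d) = (1 - κ)/2, so the argument of λ costs half the gap 1 - κ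
  -- and c² > (1 + κ)/2 suffices.
  set η : ℝ := (1 - κ) / (2 * (1 + 2 * d)) with hη
  have hη0 : 0 < η := div_pos (by linarith) (by positivity)
  have hη1 : η ≤ 1 := by
    rw [hη, div_le_one (by positivity)]
    linarith
  have hηd : η * (1 + 2 * d) = (1 - κ) / 2 := by
    rw [hη]
    field_simp
  set c : ℝ → ℝ := fun τ => (√(1 + τ ^ 2))⁻¹ with hc
  have hsqrt : ∀ τ : ℝ, 0 < √(1 + τ ^ 2) := fun τ => Real.sqrt_pos.2 (by positivity)
  have hcont : Continuous c := by
    refine Continuous.inv₀ (by fun_prop) fun τ => (hsqrt τ).ne'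
  have hc0 : c 0 = 1 := by simp [hc]
  have e1 : ∀ᶠ τ in 𝓝 (0 : ℝ), (1 + κ) / 2 < c τ ^ 2 :=
    (hcont.pow 2).continuousAt.eventually (lt_mem_nhds (by simp only [Pi.pow_apply, hc0]; linarith))
  have e2 : ∀ᶠ τ in 𝓝 (0 : ℝ), x < c τ ^ d * μ :=
    ((hcont.pow d).mul continuous_const).continuousAt.eventually
      (lt_mem_nhds (by simpa [hc0] using hxμ))
  have e3 : ∀ᶠ τ in 𝓝 (0 : ℝ), τ * (η + (d + 1 : ℕ)) < 1 :=
    (continuous_id.mul continuous_const).continuousAt.eventually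
      (gt_mem_nhds (by simp))
  -- Positivity of τ makes |arg λ| < τη hold on a full complex neighbourhood of x.
  obtain ⟨τ, ⟨h1, h2, h3⟩, hτ⟩ := (((e1.and (e2.and e3)).filter_mono nhdsWithin_le_nhds).and
    (self_mem_nhdsWithin : Set.Ioi (0 : ℝ) ∈ 𝓝[>] 0)).exists
  replace hτ : 0 < τ := hτ
  have hcpos : 0 < c τ := inv_pos.2 (hsqrt τ)
  have hcτ : c τ ^ 2 * (1 + τ ^ 2) = 1 := by
    rw [hc, inv_pow, Real.sq_sqrt (by positivity), inv_mul_cancel₀ (by positivity)]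
  have a1 : ∀ᶠ lam in 𝓝 (x : ℂ), ‖lam‖ < c τ ^ d * μ :=
    continuous_norm.continuousAt.eventually
      (gt_mem_nhds (by simpa only [Complex.norm_real, Real.norm_of_nonneg hx.le] using h2))
  have a2 : ∀ᶠ lam in 𝓝 (x : ℂ), |lam.arg| < τ * η := by
    have hslit : (x : ℂ) ∈ Complex.slitPlane := Complex.ofReal_mem_slitPlane.2 hx
    refine (Complex.continuousAt_arg hslit).abs.eventually (gt_mem_nhds ?_)
    simp only [Complex.arg_ofReal_of_nonneg hx.le, abs_zero]
    positivity
  refine ⟨τ, hτ.le, ?_⟩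
  filter_upwards [a1, a2] with lam ha1 ha2 ι s p hp
  refine ⟨fun hs => ?_, fun hs => ?_⟩
  · refine div_one_add_prod_mem_lens hτ.le hcpos hcτ hd hμ.le hη0.le hθ.ge hθ1.le hκ ?_ ha1.le
      ha2.le hp hs
    nlinarith
  · exact one_add_prod_ne_zero hτ.le hcpos hcτ h3.le ha2.le hp hs

/-! ### Transfer to `Hypergraph` -/

namespace Hypergraph

open scoped Classical in
theorem indepPoly_eq_indepSum {α : Type*} (H : Hypergraph α) (hV : H.vertexSet.Finite) (lam : ℂ) :
    H.indepPoly hV lam = indepSum lam hV.toFinset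
      {e ∈ hV.toFinset.powerset | (e : Set α) ∈ H.edgeSet} := by
  rw [indepPoly, multiIndepPoly, indepSum]
  refine Finset.sum_congr ?_ fun I _ => by rw [Finset.prod_const]
  refine Finset.filter_congr fun I hI => ?_
  have hIV : (I : Set α) ⊆ H.vertexSet := fun i hi => by
    simpa using Finset.mem_powerset.1 hI hi
  refine ⟨fun h e he => fun heI => h.2 e (Finset.mem_filter.1 he).2 (Finset.coe_subset.2 heI),
    fun h => ⟨hIV, fun e he heI => ?_⟩⟩
  have hfin : e.Finite := hV.subset (heI.trans hIV)
  refine h hfin.toFinset ?_ (by simpa using heI)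
  rw [Finset.mem_filter, Finset.mem_powerset, Set.Finite.coe_toFinset]
  exact ⟨Set.Finite.toFinset_subset_toFinset.2 (heI.trans hIV), he⟩

open scoped Classical in
theorem MaxDegreeLE.isBounded {α : Type*} {H : Hypergraph α} {D : ℕ} (hD : H.MaxDegreeLE D)
    (hV : H.vertexSet.Finite) (h : ∅ ∉ H.edgeSet) :
    IsBounded D hV.toFinset {e ∈ hV.toFinset.powerset | (e : Set α) ∈ H.edgeSet} where
  empty_notMem h' := h (by simpa using (Finset.mem_filter.1 h').2)
  subset e he := Finset.mem_powerset.1 (Finset.mem_filter.1 he).1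
  degree_le v := by
    by_cases hv : v ∈ H.vertexSet
    · refine le_trans ?_ (hD v hv)
      rw [edgeDegree, degree, ← Set.ncard_coe_finset,
        ← Set.ncard_image_of_injective _ Finset.coe_injective]
      refine Set.ncard_le_ncard ?_ (hV.finite_subsets.subset fun e he =>
        H.subset_vertexSet_of_mem_edgeSet' he.1)
      rintro _ ⟨e, he, rfl⟩
      simp only [Finset.coe_filter, Finset.mem_filter, Set.mem_ofPred_eq] at he
      exact ⟨he.1.2, he.2⟩
    · rw [edgeDegree, Finset.filter_eq_empty_iff.2, Finset.card_empty]
      · exact Nat.zero_le _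
      · intro e he hve
        have := Finset.mem_powerset.1 (Finset.mem_filter.1 he).1 hve
        exact hv (by simpa using this)

end Hypergraph

theorem theorem2 (Δ : ℕ) (hΔ : 3 ≤ Δ) :
    ∃ U : Set ℂ, IsOpen U ∧ (∀ x : ℝ, 0 < x → x < lambdaC Δ → (x : ℂ) ∈ U) ∧
      ∀ (α : Type*) (H : Hypergraph α) (hV : H.vertexSet.Finite), ∅ ∉ H.edgeSet →
        H.MaxDegreeLE Δ → ∀ lam ∈ U, H.indepPoly hV lam ≠ 0 := by
  classical
  -- Since τ depends on x, U is the interior of the set of all good λ; a neighbourhood of each x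
  -- then suffices.
  refine ⟨interior {lam | ∀ (α : Type _) (H : Hypergraph α) (hV : H.vertexSet.Finite),
    ∅ ∉ H.edgeSet → H.MaxDegreeLE Δ → H.indepPoly hV lam ≠ 0}, isOpen_interior, ?_,
    fun α H hV h0 hD lam hlam => interior_subset hlam α H hV h0 hD⟩
  intro x hx hxc
  obtain ⟨d, rfl⟩ : ∃ d, Δ = d + 1 := ⟨Δ - 1, by omega⟩
  have hxc' : x < (d : ℝ) ^ d / ((d : ℝ) - 1) ^ (d + 1) := by
    convert hxc using 1
    rw [lambdaC, Nat.add_sub_cancel]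
    push_cast
    congr 2 <;> ring
  obtain ⟨τ, hτ, hev⟩ := exists_lens_stable (by omega) hx hxc'
  rw [mem_interior_iff_mem_nhds]
  filter_upwards [hev] with lam hlam α H hV h0 hD
  rw [H.indepPoly_eq_indepSum]
  exact (Hypergraph.isZeroFree (P := lens τ) (zero_mem_lens hτ)
    (fun p hp q hq => mul_mem_lens hτ hp hq)
    (fun s p hs hp => (hlam _ s p hp).1 hs) (fun s p hs hp => (hlam _ s p hp).2 hs)
    hV.toFinset _ (hD.isBounded hV h0)).1
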